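/- **Setting.** A user has a feature vector $\theta\sim\mathcal N(0,\mathbb I_d)$. There are $K$ platforms with unit characteristic vectors $x_i\in\mathbb R^d$ and service costs $c_i\ge 0$, and a data buyer with unit characteristic vector $y\in\mathbb R^d$. Platform $i$'s signal is $s_i=x_i^\top\theta+\mathcal N(0,1)$, and what it sells is $\tilde s_i=s_i+\mathcal N(0,\sigma_i^2)$, with all noises independent. The information $\mathcal I(Z\mid S)$ revealed about $Z$ by signals $S$ is the variance of $Z$ minus the mean-squared error of the posterior mean of $Z$ given $S$. The game has four stages: (1) the platforms choose noise levels $\sigma_i$ and whether to enter ($e_i\in\{0,1\}$); (2) the user chooses with which of the platforms in the market to share ($a_i\in\{0,1\}$); (3) the platforms that have data set prices $p_i\in\mathbb R$; (4) the buyer accepts or declines each offer ($b_i\in\{0,1\}$). With $\mathcal I_i=\mathcal I(x_i^\top\theta\mid s_i)$ and $\mathcal I=\mathcal I\big(y^\top\theta\mid(\tilde s_i: e_i=a_i=b_i=1)\big)$, the user's utility is $\sum_i a_ie_i\mathcal I_i-\alpha\mathcal I$, the buyer's is $\beta\mathcal I-\sum_i b_ip_i$, and platform $i$'s is $a_i\mathcal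 I_i+b_ip_i-c_i$ if $e_i=1$ and $0$ otherwise. An equilibrium is a pure-strategy subgame perfect equilibrium in which the user chooses the largest of her optimal sets of platforms. A minimum privacy mandate $(\bar\sigma_1,\dots,\bar\sigma_K)\in[0,\infty]^K$ requires $\sigma_i\ge\bar\sigma_i$; $\bar\sigma_i=\infty$ bans platform $i$ from sharing data with the buyer. It is uniform if all $\bar\sigma_i$ are equal. Platform $i$ is high-cost if $c_i>1/2$ and low-cost if $c_i<1/2$; every platform is assumed to be one or the other. **Assumptions.** With $\gamma_i=x_i^\top y$, the vectors $x_i-\gamma_iy$ are pairwise orthogonal. Moreover $\alpha$ is such that, whichever platforms are in the market, if all noise levels are $0$ then the user's only optimal decision is to share with no platform (given that the buyer purchases all data). **Statement.** Suppose at least one platform is high-cost and $\alpha\ge\bar\alpha:=(K+1)^2/8$. Then there is $\hat\beta$ such that the following holds for every $\beta\ge\hat\beta$. 1. There is $\bar\sigma\in[0,\infty)$ such that the mandate that bans data sharing for the low-cost platforms and imposes $\bar\sigma$ on all the high-cost platforms has an equilibrium whose user utility is at least the user utility of every equilibrium under every minimum privacy mandate (uniform or not) that imposes one common level on all high-cost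 platforms, and strictly larger whenever that mandate does not ban all the low-cost platforms from sharing data. 2. If moreover at least one platform is low-cost, then there is $\bar\sigma\in[0,\infty)$ such that the mandate that bans the low-cost platforms and imposes $\bar\sigma$ on the high-cost platforms has an equilibrium, and each of its equilibria gives the user strictly more utility than every equilibrium under every uniform minimum privacy mandate (including the full ban). -/

import Mathlib

open MeasureTheory ProbabilityTheory
open scoped ENNReal NNReal

noncomputable section

/-- Revealed information about `Z` from observing the signal `S`: the reduction of the mean-squared
error of `Z`, from prior mean to posterior mean (the conditional expectation given `S`). -/
def revealedInformation {Ω F : Type*} [MeasurableSpace Ω] [MeasurableSpace F] (μ : Measure Ω)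
    (Z : Ω → ℝ) (S : Ω → F) : ℝ :=
  (∫ ω, (Z ω - ∫ ω', Z ω' ∂μ) ^ 2 ∂μ)
    - ∫ ω, (Z ω - (μ[Z | MeasurableSpace.comap S inferInstance]) ω) ^ 2 ∂μ

/-- The data of a three-layer data market with `K` platforms and a user feature vector in `ℝ^d`. -/
structure Market (d K : ℕ) where
  /-- characteristics of the platforms -/
  x : Fin K → EuclideanSpace ℝ (Fin d)
  /-- characteristics of the data buyer -/
  y : EuclideanSpace ℝ (Fin d)
  /-- per-user service costs of the platforms -/
  c : Fin K → ℝ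
  norm_x : ∀ i, ‖x i‖ = 1
  norm_y : ‖y‖ = 1
  c_nonneg : ∀ i, 0 ≤ c i

/-- Sample space: the coordinates of the user's feature vector, the noises with which the user's
data reach the platforms, and the (normalized) noises that the platforms add. -/
abbrev Sample (d K : ℕ) : Type := Fin d ⊕ (Fin K ⊕ Fin K) → ℝ

/-- All the primitive random variables are independent standard Gaussians. -/
def sampleLaw (d K : ℕ) : Measure (Sample d K) :=
  Measure.pi fun _ => gaussianReal 0 1

/-- Noise levels (standard deviations), one per platform; `⊤` means that the data of the platform
are not shared with the buyer (infinite noise). -/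
abbrev NoiseLevels (K : ℕ) : Type := Fin K → ℝ≥0∞

namespace Market

variable {d K : ℕ} (M : Market d K)

/-- The linear function `vᵀθ` of the user's feature vector `θ ∼ N(0, I_d)`. -/
def feature (v : EuclideanSpace ℝ (Fin d)) (ω : Sample d K) : ℝ :=
  ∑ j, v j * ω (Sum.inl j)

/-- The signal `s_i = x_iᵀθ + N(0,1)` received by platform `i`. -/
def signal (i : Fin K) (ω : Sample d K) : ℝ :=
  feature (M.x i) ω + ω (Sum.inr (Sum.inl i))

/-- The signal `s_i + N(0, σ_i²)` sold by platform `i`, for a finite noise level `σ_i`. -/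
def soldSignal (σ : NoiseLevels K) (i : Fin K) (ω : Sample d K) : ℝ :=
  M.signal i ω + (σ i).toReal * ω (Sum.inr (Sum.inr i))

/-- `𝓘_i`: the information about `x_iᵀθ` revealed to platform `i` by its signal. -/
def platformInfo (i : Fin K) : ℝ :=
  revealedInformation (sampleLaw d K) (feature (M.x i)) (M.signal i)

/-- `𝓘(σ_S)`: the information about `yᵀθ` revealed to the buyer when it obtains the data of
exactly the platforms in `S`. A signal with infinite noise is no signal. -/
def buyerInfo (σ : NoiseLevels K) (S : Finset (Fin K)) : ℝ :=
  revealedInformation (sampleLaw d K) (feature M.y)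
    (fun ω (i : {i // i ∈ S ∧ σ i ≠ ⊤}) => M.soldSignal σ i ω)

/-! The vectors `e, a, b ∈ {0,1}^K` are given by the sets `E`, `A`, `B` of the platforms with
entry one: platforms in the market, platforms the user shares with, offers the buyer accepts.
Only platforms in `E ∩ A` have data to offer, and prices matter only for them. -/

/-- The user's utility. -/
def userUtility (α : ℝ) (σ : NoiseLevels K) (E A B : Finset (Fin K)) : ℝ :=
  ∑ i ∈ E ∩ A, M.platformInfo i - α * M.buyerInfo σ (E ∩ A ∩ B)

/-- The utility of platform `i`. -/
def platformUtility (i : Fin K) (E A : Finset (Fin K)) (p : Fin K → ℝ) (B : Finset (Fin K)) : ℝ :=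
  if i ∈ E then
    (if i ∈ A then M.platformInfo i else 0) + (if i ∈ A ∩ B then p i else 0) - M.c i
  else 0

/-- The data buyer's utility. -/
def buyerUtility (β : ℝ) (σ : NoiseLevels K) (E A : Finset (Fin K)) (p : Fin K → ℝ)
    (B : Finset (Fin K)) : ℝ :=
  β * M.buyerInfo σ (E ∩ A ∩ B) - ∑ i ∈ E ∩ A ∩ B, p i

/-- High-cost platforms. -/
def IsHighCost (i : Fin K) : Prop := 1 / 2 < M.c i

/-- Low-cost platforms. -/
def IsLowCost (i : Fin K) : Prop := M.c i < 1 / 2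

/-- The correlation `γ_i` between platform `i` and the buyer. -/
def γ (i : Fin K) : ℝ := inner ℝ (M.x i) M.y

/-- The platforms' data are substitutes: the residuals `x_i - γ_i y` are pairwise orthogonal. -/
def Substitutes : Prop :=
  ∀ i j, i ≠ j → inner ℝ (M.x i - M.γ i • M.y) (M.x j - M.γ j • M.y) = 0

/-- The sharing decisions that are optimal for the user, when the buyer purchases all the data. -/
def userEquilibria (α : ℝ) (σ : NoiseLevels K) (E : Finset (Fin K)) : Set (Finset (Fin K)) :=
  {A | A ⊆ E ∧ ∀ A' ⊆ E, M.userUtility α σ E A' Finset.univ ≤ M.userUtility α σ E A Finset.univ}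

/-- The user requires some privacy: whichever platforms are in the market, if none of them adds
noise, then the largest optimal sharing decision is to share with none of them. -/
def RequiresPrivacy (α : ℝ) : Prop :=
  ∀ E : Finset (Fin K), IsGreatest (M.userEquilibria α (fun _ => 0) E) ∅

/-- The noise level `r` is allowed by the lower bound `r₀`: at least `r₀`, and finite unless `r₀`
is infinite (a ban). -/
def Allowed (r₀ r : ℝ≥0∞) : Prop := r₀ ≤ r ∧ (r = ⊤ → r₀ = ⊤)

/-- A strategy profile of the four-stage game: the platforms' noise levels and entry decisions, the
user's sharing decision, the platforms' prices, and the buyer's purchases, each decision being a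
function of everything that has been decided in the previous stages. -/
structure _root_.StrategyProfile (K : ℕ) where
  noise : NoiseLevels K
  entry : Finset (Fin K)
  share : NoiseLevels K → Finset (Fin K) → Finset (Fin K)
  price : NoiseLevels K → Finset (Fin K) → Finset (Fin K) → Fin K → ℝ
  buy : NoiseLevels K → Finset (Fin K) → Finset (Fin K) → (Fin K → ℝ) → Finset (Fin K)

variable (s : StrategyProfile K)

/-- The user's utility when, after the first-stage decisions `(σ, E)` and the sharing decision `A`,
the game is continued according to `s`. -/
def userContinuation (α : ℝ) (σ : NoiseLevels K) (E A : Finset (Fin K)) : ℝ :=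
  M.userUtility α σ E A (s.buy σ E A (s.price σ E A))

/-- The utility of platform `i` when, after the first-stage decisions `(σ, E)`, the game is
continued according to `s`. -/
def platformContinuation (i : Fin K) (σ : NoiseLevels K) (E : Finset (Fin K)) : ℝ :=
  M.platformUtility i E (s.share σ E) (s.price σ E (s.share σ E))
    (s.buy σ E (s.share σ E) (s.price σ E (s.share σ E)))

/-- The user's utility in the outcome of `s`. -/
def userPayoff (α : ℝ) : ℝ :=
  M.userContinuation s α s.noise s.entry (s.share s.noise s.entry)

/-- Subgame perfect equilibrium of the game with parameters `α, β` under the minimum privacy mandate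
`m` (a lower bound `m i` on the noise level of each platform `i`, where `⊤` is a ban on sharing with
the buyer). As the platforms move first, the user breaks ties in their favour: the user's choice is
the largest optimal set of platforms. -/
structure IsEquilibrium (α β : ℝ) (m : NoiseLevels K) : Prop where
  allowed : ∀ i, Allowed (m i) (s.noise i)
  /-- fourth stage: the buyer's purchases are optimal -/
  buyer : ∀ σ : NoiseLevels K, (∀ i, Allowed (m i) (σ i)) →
    ∀ E : Finset (Fin K), ∀ A ⊆ E, ∀ (p : Fin K → ℝ) (B : Finset (Fin K)),
      M.buyerUtility β σ E A p B ≤ M.buyerUtility β σ E A p (s.buy σ E A p)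
  /-- third stage: no platform gains by changing its price -/
  pricing : ∀ σ : NoiseLevels K, (∀ i, Allowed (m i) (σ i)) →
    ∀ E : Finset (Fin K), ∀ A ⊆ E, ∀ (i : Fin K) (q : ℝ),
      M.platformUtility i E A (Function.update (s.price σ E A) i q)
          (s.buy σ E A (Function.update (s.price σ E A) i q))
        ≤ M.platformUtility i E A (s.price σ E A) (s.buy σ E A (s.price σ E A))
  /-- second stage: the user's sharing decision is the largest optimal one -/
  sharing : ∀ σ : NoiseLevels K, (∀ i, Allowed (m i) (σ i)) →
    ∀ E : Finset (Fin K),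
      IsGreatest {A | A ⊆ E ∧ ∀ A' ⊆ E,
        M.userContinuation s α σ E A' ≤ M.userContinuation s α σ E A} (s.share σ E)
  /-- first stage: no platform gains by changing its noise level and entry decision -/
  platforms : ∀ (i : Fin K) (r : ℝ≥0∞), Allowed (m i) r →
    ∀ E : Finset (Fin K), (∀ j, j ≠ i → (j ∈ E ↔ j ∈ s.entry)) →
      M.platformContinuation s i (Function.update s.noise i r) E
        ≤ M.platformContinuation s i s.noise s.entry

open Classical in
/-- The mandate that bans data sharing for the low-cost platforms and imposes the finite minimum
noise level `r` on the high-cost ones. -/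
def banLowCost (r : ℝ≥0) : NoiseLevels K :=
  fun i => if M.IsLowCost i then ⊤ else (r : ℝ≥0∞)

end Market

end

/-!
# Banning data sharing by low-cost platforms

Information and prices. Since `x_i - γ_i y` are pairwise orthogonal, the sold signals are, given `yᵀθ`,
independent Gaussian observations of it, so the buyer's information is `W / (1 + W)`, where the
total precision `W` is the sum of the precisions `γ_i² / (2 - γ_i² + σ_i²)` of the signals
(`buyerInfo_eq`; the conditional expectation is the best linear predictor,
`revealedInformation_dotProduct`). This function is concave in `W`, so the data are substitutes:
in every continuation equilibrium each platform with data is paid exactly `β` times its marginal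
information, and all informative data are sold (`IsEquilibrium.revenue_eq`).

Bounding the equilibria under a mandate `m`. Sharing with a platform is worth `1/2` to the user.
If an equilibrium gives her more than `(K - 1) / 2`, then sharing with all `K` platforms is her only
optimal decision. This persists if a platform slightly lowers its noise, which raises its price, so
every platform uses the lowest noise level allowed; and no platform prefers to stay out, so `m` is
`Viable` (`IsEquilibrium.of_lt_userPayoff`). Conversely, if the noise is so large that all the data
together cost the user less than `1/2`, she shares with every entrant, and a viable `m` has an
equilibrium in which all platforms enter with the lowest noise (`exists_isEquilibrium`); if
all of them profit strictly, no other user utility is possible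
(`IsEquilibrium.userPayoff_eq_of_small`).

Comparison. For `β` large there are viable mandates under which all the data cost the user less
than `1/2`, so only equilibria with full entry at minimal noise compete, and the larger the minimal
noise, the better for the user. Banning the low-cost platforms, which enter anyway for the service
revenue, removes their information from the buyer and raises the marginal value of the data of the
high-cost platforms. Hence a common level that is viable for the high-cost platforms without the ban
is viable with it (`Viable.banLowCost`), and the largest viable level with the ban (which exists by
`exists_isGreatest_viable`) is optimal. For the comparison with uniform mandates the level is the
largest viable uniform one: with the ban, it leaves strict profits to all platforms
(`Viable.banLowCost_lt`), so that every equilibrium gives the same, strictly larger, utility.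
-/

/-! ### Information revealed by Gaussian linear observations -/

section LinearForms

variable {ι κ : Type*} [Fintype ι] [Fintype κ]

/-- The law of a vector of independent standard Gaussian variables indexed by `ι`. -/
noncomputable abbrev stdGaussianPi (ι : Type*) [Fintype ι] : Measure (ι → ℝ) :=
  Measure.pi fun _ => gaussianReal 0 1

lemma hasGaussianLaw_id_stdGaussianPi :
    HasGaussianLaw (fun ω : ι → ℝ => fun i => ω i) (stdGaussianPi ι) := by
  have hlaw : ∀ i : ι, HasGaussianLaw (fun ω : ι → ℝ => ω i) (stdGaussianPi ι) := fun i =>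
    (HasLaw.mk (μ := gaussianReal 0 1) (measurable_pi_apply i).aemeasurable
      (measurePreserving_eval (fun _ : ι => gaussianReal 0 1) i).map_eq).hasGaussianLaw
  refine iIndepFun.hasGaussianLaw hlaw ?_
  exact iIndepFun_pi (μ := fun _ : ι => gaussianReal 0 1) (X := fun _ => id)
    (fun _ => aemeasurable_id)

lemma hasGaussianLaw_dotProduct (a : κ → ι → ℝ) :
    HasGaussianLaw (fun ω : ι → ℝ => fun j => a j ⬝ᵥ ω) (stdGaussianPi ι) := by
  have := (hasGaussianLaw_id_stdGaussianPi (ι := ι)).map_fun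
    (LinearMap.toContinuousLinearMap (Matrix.mulVecLin (Matrix.of a)))
  exact this

lemma hasGaussianLaw_dotProduct_single (a : ι → ℝ) :
    HasGaussianLaw (fun ω : ι → ℝ => a ⬝ᵥ ω) (stdGaussianPi ι) :=
  (hasGaussianLaw_dotProduct (κ := Unit) fun _ => a).eval ()

lemma covariance_eval_stdGaussianPi [DecidableEq ι] (i j : ι) :
    cov[fun ω : ι → ℝ => ω i, fun ω => ω j; stdGaussianPi ι] = if i = j then 1 else 0 := by
  have hlaw := fun k : ι => (measurePreserving_eval (fun _ : ι => gaussianReal 0 1) k)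
  split_ifs with h
  · subst h
    rw [covariance_self (measurable_pi_apply i).aemeasurable]
    have := variance_id_gaussianReal (μ := 0) (v := 1)
    rw [← (hlaw i).map_eq, variance_map (by fun_prop) (hlaw i).measurable.aemeasurable] at this
    simpa using this
  · have hi : iIndepFun (fun k (ω : ι → ℝ) => ω k) (stdGaussianPi ι) :=
      iIndepFun_pi (μ := fun _ : ι => gaussianReal 0 1) (X := fun _ => id)
        (fun _ => aemeasurable_id)
    exact (hi.indepFun h).covariance_eq_zero
      (hasGaussianLaw_id_stdGaussianPi.eval i).memLp_two
      (hasGaussianLaw_id_stdGaussianPi.eval j).memLp_two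

lemma covariance_dotProduct (a b : ι → ℝ) :
    cov[fun ω : ι → ℝ => a ⬝ᵥ ω, fun ω => b ⬝ᵥ ω; stdGaussianPi ι] = a ⬝ᵥ b := by
  classical
  have hL : ∀ (c : ι → ℝ) (i : ι), MemLp (fun ω : ι → ℝ => c i * ω i) 2 (stdGaussianPi ι) :=
    fun c i => (hasGaussianLaw_id_stdGaussianPi.eval i).memLp_two.const_mul _
  simp only [dotProduct]
  rw [covariance_fun_sum_fun_sum (hL a) (hL b)]
  simp [covariance_const_mul_left, covariance_const_mul_right, covariance_eval_stdGaussianPi,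
    mul_comm]

lemma integral_dotProduct (a : ι → ℝ) : ∫ ω, a ⬝ᵥ ω ∂stdGaussianPi ι = 0 := by
  have h : ∀ i : ι, ∫ ω : ι → ℝ, ω i ∂stdGaussianPi ι = 0 := fun i => by
    have := integral_id_gaussianReal (μ := 0) (v := 1)
    rw [← (measurePreserving_eval (fun _ : ι => gaussianReal 0 1) i).map_eq,
      integral_map (measurable_pi_apply i).aemeasurable (by fun_prop)] at this
    simpa using this
  simp only [dotProduct]
  rw [integral_finsetSum _ fun i _ =>
    ((hasGaussianLaw_id_stdGaussianPi.eval i).integrable).const_mul _]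
  simp [integral_const_mul, h]

lemma integral_dotProduct_sq (a : ι → ℝ) : ∫ ω, (a ⬝ᵥ ω) ^ 2 ∂stdGaussianPi ι = a ⬝ᵥ a := by
  have h := covariance_dotProduct a a
  rw [covariance_self (by fun_prop), variance_of_integral_eq_zero (by fun_prop)
    (integral_dotProduct a)] at h
  exact h

/-- The best linear predictor `∑ j, l j • s j` of a Gaussian linear form `z` from linear forms `s j`
is its conditional expectation: the residual is uncorrelated with, hence independent of, the
observations. The information is then the covariance of `z` with its predictor. -/
lemma revealedInformation_dotProduct (z : ι → ℝ) (s : κ → ι → ℝ) (l : κ → ℝ)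
    (h : ∀ j, (z - ∑ k, l k • s k) ⬝ᵥ s j = 0) :
    revealedInformation (stdGaussianPi ι) (fun ω => z ⬝ᵥ ω) (fun ω j => s j ⬝ᵥ ω)
      = ∑ j, l j * (s j ⬝ᵥ z) := by
  set e := z - ∑ k, l k • s k with he
  set S : (ι → ℝ) → κ → ℝ := fun ω j => s j ⬝ᵥ ω with hS
  have hSm : Measurable S := by fun_prop
  have hle := hSm.comap_le
  have hz : ∀ ω : ι → ℝ, z ⬝ᵥ ω = e ⬝ᵥ ω + ∑ k, l k * S ω k := fun ω => by
    simp [he, hS, sub_dotProduct, sum_dotProduct]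
  have hind : IndepFun (fun ω : ι → ℝ => e ⬝ᵥ ω) S (stdGaussianPi ι) := by
    have hg : HasGaussianLaw (fun ω : ι → ℝ => ((fun _ : Unit => e ⬝ᵥ ω), S ω))
        (stdGaussianPi ι) := by
      have := (hasGaussianLaw_id_stdGaussianPi (ι := ι)).map_fun (LinearMap.toContinuousLinearMap
        ((Matrix.mulVecLin (Matrix.of fun _ : Unit => e)).prod (Matrix.mulVecLin (Matrix.of s))))
      exact this
    have h2 := HasGaussianLaw.indepFun_of_covariance_eval
      (X := fun _ : Unit => fun ω : ι → ℝ => e ⬝ᵥ ω) (Y := fun j ω => s j ⬝ᵥ ω) hg fun _ j => by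
        rw [covariance_dotProduct, h j]
    exact h2.comp (φ := fun f : Unit → ℝ => f ()) (ψ := id) (by fun_prop) (by fun_prop)
  have hInd : Indep (MeasurableSpace.comap (fun ω : ι → ℝ => e ⬝ᵥ ω) inferInstance)
      (MeasurableSpace.comap S inferInstance) (stdGaussianPi ι) := hind
  have hce : (stdGaussianPi ι)[fun ω => z ⬝ᵥ ω | MeasurableSpace.comap S inferInstance]
      =ᵐ[stdGaussianPi ι] fun ω => ∑ k, l k * S ω k := by
    have hzf : (fun ω : ι → ℝ => z ⬝ᵥ ω)
        = (fun ω => e ⬝ᵥ ω) + fun ω => ∑ k, l k * S ω k := funext hz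
    have hpm : StronglyMeasurable[MeasurableSpace.comap S inferInstance]
        (fun ω => ∑ k, l k * S ω k) := by
      have : Measurable[MeasurableSpace.comap S inferInstance] (fun ω => ∑ k, l k * S ω k) :=
        (show Measurable fun f : κ → ℝ => ∑ k, l k * f k by fun_prop).comp
          (comap_measurable S)
      exact this.stronglyMeasurable
    have hpi : Integrable (fun ω => ∑ k, l k * S ω k) (stdGaussianPi ι) :=
      integrable_finsetSum _ fun k _ =>
        (hasGaussianLaw_dotProduct_single (s k)).integrable.const_mul _
    rw [hzf]
    refine (condExp_add (hasGaussianLaw_dotProduct_single e).integrable hpi _).trans ?_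
    have h1 := condExp_indep_eq (μ := stdGaussianPi ι)
      (show Measurable fun ω : ι → ℝ => e ⬝ᵥ ω by fun_prop).comap_le hle
      (comap_measurable (fun ω : ι → ℝ => e ⬝ᵥ ω)).stronglyMeasurable hInd
    have h2 := condExp_of_stronglyMeasurable hle hpm hpi
    rw [h2]
    filter_upwards [h1] with ω hω
    simp [hω, integral_dotProduct]
  have hmse : ∫ ω, (z ⬝ᵥ ω - ((stdGaussianPi ι)[fun ω => z ⬝ᵥ ω |
      MeasurableSpace.comap S inferInstance]) ω) ^ 2 ∂stdGaussianPi ι = e ⬝ᵥ e := by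
    rw [← integral_dotProduct_sq]
    refine integral_congr_ae ?_
    filter_upwards [hce] with ω hω
    rw [hω, hz ω]; ring
  rw [revealedInformation, hmse, integral_dotProduct]
  simp only [sub_zero]
  rw [integral_dotProduct_sq]
  have hee : e ⬝ᵥ e = e ⬝ᵥ z := by
    conv_lhs => rhs; rw [he]
    rw [dotProduct_sub, dotProduct_sum]
    simp [dotProduct_smul, h]
  rw [hee, he, sub_dotProduct, sum_dotProduct]
  simp

/-- The same as `revealedInformation_dotProduct`, for one real-valued observation. -/
lemma revealedInformation_dotProduct_single (z s : ι → ℝ) (l : ℝ)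
    (h : (z - l • s) ⬝ᵥ s = 0) :
    revealedInformation (stdGaussianPi ι) (fun ω => z ⬝ᵥ ω) (fun ω => s ⬝ᵥ ω) = l * (s ⬝ᵥ z) := by
  have h1 := revealedInformation_dotProduct z (fun _ : Unit => s) (fun _ => l) (by simpa using h)
  simp only [Finset.univ_unique, Finset.sum_const, Finset.card_singleton, one_smul] at h1
  rw [← h1, revealedInformation, revealedInformation]
  have hc : MeasurableSpace.comap (fun (ω : ι → ℝ) (_ : Unit) => s ⬝ᵥ ω) MeasurableSpace.pi
      = MeasurableSpace.comap (fun ω : ι → ℝ => s ⬝ᵥ ω) inferInstance := by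
    rw [MeasurableSpace.pi, MeasurableSpace.comap_iSup]
    simp only [MeasurableSpace.comap_comp, ciSup_unique]
    rfl
  rw [hc]

end LinearForms

/-! ### Information as a function of precision -/

/-- The reduction of the unit prior variance of a Gaussian variable when signals of total precision
`w` are observed. -/
noncomputable def infoOfPrecision (w : ℝ) : ℝ := 1 - (1 + w)⁻¹

lemma infoOfPrecision_zero : infoOfPrecision 0 = 0 := by simp [infoOfPrecision]

lemma infoOfPrecision_strictMonoOn : StrictMonoOn infoOfPrecision (Set.Ici 0) := by
  intro a ha b hb hab
  simp only [Set.mem_Ici] at ha hb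
  have := inv_strictAnti₀ (show 0 < 1 + a by linarith) (show 1 + a < 1 + b by linarith)
  simp only [infoOfPrecision]; linarith

lemma infoOfPrecision_lt {a b : ℝ} (ha : 0 ≤ a) (hab : a < b) :
    infoOfPrecision a < infoOfPrecision b :=
  infoOfPrecision_strictMonoOn ha (ha.trans hab.le) hab

lemma infoOfPrecision_le {a b : ℝ} (ha : 0 ≤ a) (hab : a ≤ b) :
    infoOfPrecision a ≤ infoOfPrecision b :=
  infoOfPrecision_strictMonoOn.monotoneOn ha (ha.trans hab) hab

lemma infoOfPrecision_nonneg {a : ℝ} (ha : 0 ≤ a) : 0 ≤ infoOfPrecision a :=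
  infoOfPrecision_zero ▸ infoOfPrecision_le le_rfl ha

lemma infoOfPrecision_le_self {a : ℝ} (ha : 0 ≤ a) : infoOfPrecision a ≤ a := by
  have h : infoOfPrecision a = a * (1 + a)⁻¹ := by
    have : 1 + a ≠ 0 := by positivity
    simp only [infoOfPrecision]; field_simp; ring
  rw [h]
  exact mul_le_of_le_one_right ha (inv_le_one_of_one_le₀ (by linarith))

lemma infoOfPrecision_add_sub {a w : ℝ} (ha : 0 ≤ a) (hw : 0 ≤ w) :
    infoOfPrecision (a + w) - infoOfPrecision a = w / ((1 + a) * (1 + (a + w))) := by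
  have h1 : 1 + a ≠ 0 := by positivity
  have h2 : 1 + (a + w) ≠ 0 := by positivity
  simp only [infoOfPrecision]; field_simp; ring

/-- Diminishing returns. -/
lemma infoOfPrecision_add_sub_le {a b w : ℝ} (ha : 0 ≤ a) (hab : a ≤ b) (hw : 0 ≤ w) :
    infoOfPrecision (b + w) - infoOfPrecision b ≤ infoOfPrecision (a + w) - infoOfPrecision a := by
  rw [infoOfPrecision_add_sub ha hw, infoOfPrecision_add_sub (ha.trans hab) hw]
  have : 0 ≤ b := ha.trans hab
  gcongr

lemma infoOfPrecision_add_sub_lt {a b w : ℝ} (ha : 0 ≤ a) (hab : a < b) (hw : 0 < w) :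
    infoOfPrecision (b + w) - infoOfPrecision b < infoOfPrecision (a + w) - infoOfPrecision a := by
  rw [infoOfPrecision_add_sub ha hw.le, infoOfPrecision_add_sub (ha.trans hab.le) hw.le]
  gcongr

namespace Market

variable {d K : ℕ} (M : Market d K)

/-! ### Information revealed to the platforms and to the buyer -/

/-- The coefficients of the linear form `vᵀθ` in the primitive random variables. -/
def featureCoeff (v : EuclideanSpace ℝ (Fin d)) : Fin d ⊕ (Fin K ⊕ Fin K) → ℝ :=
  Sum.elim (fun j => v j) 0

/-- The coefficients of the signal of platform `i` with added noise of standard deviation `r`. -/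
def signalCoeff (i : Fin K) (r : ℝ) : Fin d ⊕ (Fin K ⊕ Fin K) → ℝ :=
  Sum.elim (fun j => M.x i j) (Sum.elim (Pi.single i 1) (Pi.single i r))

lemma feature_eq_dotProduct (v : EuclideanSpace ℝ (Fin d)) :
    feature (K := K) v = fun ω => featureCoeff v ⬝ᵥ ω := by
  funext ω
  simp [feature, featureCoeff, dotProduct]

lemma signal_eq_dotProduct (i : Fin K) : M.signal i = fun ω => M.signalCoeff i 0 ⬝ᵥ ω := by
  funext ω
  simp [signal, feature, signalCoeff, dotProduct, Pi.single_apply]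

lemma soldSignal_eq_dotProduct (σ : NoiseLevels K) (i : Fin K) :
    M.soldSignal σ i = fun ω => M.signalCoeff i (σ i).toReal ⬝ᵥ ω := by
  funext ω
  simp [soldSignal, signal, feature, signalCoeff, dotProduct, Pi.single_apply, add_assoc]

lemma signalCoeff_dotProduct_featureCoeff (i : Fin K) (r : ℝ) (v : EuclideanSpace ℝ (Fin d)) :
    M.signalCoeff i r ⬝ᵥ featureCoeff v = inner ℝ (M.x i) v := by
  simp [featureCoeff, signalCoeff, dotProduct, PiLp.inner_apply, mul_comm]

lemma signalCoeff_dotProduct (i j : Fin K) (r q : ℝ) :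
    M.signalCoeff i r ⬝ᵥ M.signalCoeff j q
      = inner ℝ (M.x i) (M.x j) + if i = j then 1 + r * q else 0 := by
  rcases eq_or_ne i j with rfl | h
  · simp [signalCoeff, dotProduct, PiLp.inner_apply, Pi.single_apply,
      -inner_self_eq_norm_sq_to_K]
  · simp [signalCoeff, dotProduct, PiLp.inner_apply, mul_comm, Pi.single_apply, h, h.symm]

lemma inner_x_self (i : Fin K) : inner ℝ (M.x i) (M.x i) = (1 : ℝ) := by
  rw [real_inner_self_eq_norm_sq, M.norm_x]; norm_num

lemma platformInfo_eq (i : Fin K) : M.platformInfo i = 1 / 2 := by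
  rw [platformInfo, feature_eq_dotProduct, signal_eq_dotProduct]
  have h := revealedInformation_dotProduct_single (featureCoeff (M.x i)) (M.signalCoeff i 0) (1 / 2)
    (by
      rw [sub_dotProduct, smul_dotProduct, dotProduct_comm, signalCoeff_dotProduct_featureCoeff,
        signalCoeff_dotProduct, M.inner_x_self]
      norm_num)
  rw [signalCoeff_dotProduct_featureCoeff, M.inner_x_self, mul_one] at h
  exact h

lemma γ_sq_le_one (i : Fin K) : M.γ i ^ 2 ≤ 1 := by
  have h := abs_real_inner_le_norm (M.x i) M.y
  rw [M.norm_x, M.norm_y, one_mul] at h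
  rw [← sq_abs]
  exact pow_le_one₀ (abs_nonneg _) h

/-- The precision about `yᵀθ` of the signal sold by platform `i` with noise level `r`: given
`yᵀθ`, the signal divided by `γ_i` has variance `(2 - γ_i² + r²) / γ_i²`. -/
noncomputable def precision (i : Fin K) (r : ℝ≥0∞) : ℝ :=
  if r = ⊤ then 0 else M.γ i ^ 2 / (2 - M.γ i ^ 2 + r.toReal ^ 2)

/-- The total precision of the signals of the platforms in `S`. -/
noncomputable def totalPrecision (σ : NoiseLevels K) (S : Finset (Fin K)) : ℝ :=
  ∑ i ∈ S, M.precision i (σ i)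

lemma inner_x_x (hsub : M.Substitutes) {i j : Fin K} (h : i ≠ j) :
    inner ℝ (M.x i) (M.x j) = M.γ i * M.γ j := by
  have := hsub i j h
  rw [inner_sub_left, inner_sub_right, inner_sub_right, inner_smul_left, inner_smul_left,
    inner_smul_right, inner_smul_right, real_inner_self_eq_norm_sq, M.norm_y,
    real_inner_comm (M.x j) M.y] at this
  simp only [γ] at *
  simp at this
  linarith [mul_comm (inner ℝ (M.x j) M.y) (inner ℝ (M.x i) M.y)]

lemma precision_top (i : Fin K) : M.precision i ⊤ = 0 := by simp [precision]

lemma precision_nonneg (i : Fin K) (r : ℝ≥0∞) : 0 ≤ M.precision i r := by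
  have := M.γ_sq_le_one i
  unfold precision
  split_ifs
  · rfl
  · exact div_nonneg (sq_nonneg _) (by nlinarith [sq_nonneg r.toReal])

lemma totalPrecision_nonneg (σ : NoiseLevels K) (S : Finset (Fin K)) :
    0 ≤ M.totalPrecision σ S :=
  Finset.sum_nonneg fun i _ => M.precision_nonneg i _

lemma buyerInfo_eq (hsub : M.Substitutes) (σ : NoiseLevels K) (S : Finset (Fin K)) :
    M.buyerInfo σ S = infoOfPrecision (M.totalPrecision σ S) := by
  classical
  set W := M.totalPrecision σ S with hW
  have hW0 : 0 ≤ W := M.totalPrecision_nonneg σ S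
  have hW1 : 1 + W ≠ 0 := by positivity
  -- conditional variance of the signal given the feature of the buyer
  set v : Fin K → ℝ := fun i => 2 - M.γ i ^ 2 + (σ i).toReal ^ 2 with hv
  have hv0 : ∀ i, v i ≠ 0 := fun i => by
    have := M.γ_sq_le_one i
    have : 0 < v i := by simp only [hv]; nlinarith [sq_nonneg (σ i).toReal]
    exact this.ne'
  set l : {i // i ∈ S ∧ σ i ≠ ⊤} → ℝ := fun i => M.γ i / v i / (1 + W) with hl
  have hlW : ∑ i, l i * M.γ i = W / (1 + W) := by
    have h1 : W = ∑ i : {i // i ∈ S ∧ σ i ≠ ⊤}, M.γ i ^ 2 / v i := by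
      rw [hW, totalPrecision]
      have h2 : ∀ i ∈ S, M.precision i (σ i) = if σ i ≠ ⊤ then M.γ i ^ 2 / v i else 0 := by
        intro i _
        by_cases h : σ i = ⊤ <;> simp [precision, h, hv]
      rw [Finset.sum_congr rfl h2, ← Finset.sum_filter]
      exact Finset.sum_subtype _ (by simp) _
    conv_rhs => lhs; rw [h1]
    rw [Finset.sum_div]
    refine Finset.sum_congr rfl fun i _ => ?_
    simp only [hl]; field_simp
  have hmain := revealedInformation_dotProduct (featureCoeff M.y)
    (fun i : {i // i ∈ S ∧ σ i ≠ ⊤} => M.signalCoeff i (σ i).toReal) l (by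
      intro j
      have hsum : ∑ k, l k * (M.signalCoeff k (σ k).toReal ⬝ᵥ M.signalCoeff j (σ j).toReal)
          = M.γ j * (W / (1 + W)) + l j * v j := by
        rw [← hlW, Finset.mul_sum]
        have : ∀ k, l k * (M.signalCoeff k (σ k).toReal ⬝ᵥ M.signalCoeff j (σ j).toReal)
            = M.γ j * (l k * M.γ k) + if k = j then l k * v k else 0 := by
          intro k
          rw [signalCoeff_dotProduct]
          by_cases hkj : k = j
          · subst hkj
            rw [M.inner_x_self]; simp [hv]; ring
          · have : (k : Fin K) ≠ j := fun h => hkj (Subtype.ext h)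
            rw [M.inner_x_x hsub this]; simp [hkj, this]; ring
        rw [Finset.sum_congr rfl fun k _ => this k, Finset.sum_add_distrib]
        simp
      rw [sub_dotProduct, sum_dotProduct, dotProduct_comm, signalCoeff_dotProduct_featureCoeff]
      simp only [smul_dotProduct, smul_eq_mul]
      rw [hsum]
      have h0 := hv0 j
      change M.γ j - _ = 0
      simp only [hl]
      field_simp
      ring)
  have : M.buyerInfo σ S = ∑ i, l i * M.γ i := by
    rw [buyerInfo, feature_eq_dotProduct]
    simp only [soldSignal_eq_dotProduct]
    refine hmain.trans (Finset.sum_congr rfl fun i _ => ?_)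
    rw [signalCoeff_dotProduct_featureCoeff]; rfl
  rw [this, hlW, infoOfPrecision]
  field_simp
  ring

end Market

namespace Market

variable {d K : ℕ} (M : Market d K)

/-! ### Precision and marginal information -/

lemma two_sub_γ_sq_pos (i : Fin K) (r : ℝ) : 0 < 2 - M.γ i ^ 2 + r ^ 2 := by
  nlinarith [M.γ_sq_le_one i, sq_nonneg r]

lemma precision_coe (i : Fin K) (r : ℝ≥0) :
    M.precision i r = M.γ i ^ 2 / (2 - M.γ i ^ 2 + (r : ℝ) ^ 2) := by
  simp [precision]

lemma continuous_precision_coe (i : Fin K) : Continuous fun r : ℝ≥0 => M.precision i r := by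
  simp only [precision_coe]
  exact continuous_const.div (by fun_prop) fun r => (M.two_sub_γ_sq_pos i r).ne'

lemma precision_pos {i : Fin K} (hγ : M.γ i ≠ 0) {r : ℝ≥0∞} (hr : r ≠ ⊤) :
    0 < M.precision i r := by
  lift r to ℝ≥0 using hr
  rw [precision_coe]
  have := M.two_sub_γ_sq_pos i r
  positivity

lemma precision_lt {i : Fin K} (hγ : M.γ i ≠ 0) {r q : ℝ≥0∞} (h : r < q) :
    M.precision i q < M.precision i r := by
  lift r to ℝ≥0 using h.ne_top
  rcases eq_or_ne q ⊤ with rfl | hq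
  · rw [precision_top]; exact M.precision_pos hγ ENNReal.coe_ne_top
  · lift q to ℝ≥0 using hq
    rw [precision_coe, precision_coe]
    have h' : (r : ℝ) < q := by exact_mod_cast h
    have := M.two_sub_γ_sq_pos i r
    gcongr

lemma precision_antitone (i : Fin K) : Antitone (M.precision i) := by
  intro r q h
  by_cases hγ : M.γ i = 0
  · simp [precision, hγ]
  · rcases h.eq_or_lt with rfl | h
    · rfl
    · exact (M.precision_lt hγ h).le

/-- The noise level makes the precision small, uniformly over the characteristics. -/
lemma precision_mul_sq_le_one (i : Fin K) (r : ℝ≥0) : M.precision i r * (r : ℝ) ^ 2 ≤ 1 := by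
  rw [precision_coe, div_mul_eq_mul_div, div_le_one (M.two_sub_γ_sq_pos i r)]
  nlinarith [M.γ_sq_le_one i, sq_nonneg (r : ℝ)]

lemma totalPrecision_le_of_subset (σ : NoiseLevels K) {S T : Finset (Fin K)} (h : S ⊆ T) :
    M.totalPrecision σ S ≤ M.totalPrecision σ T :=
  Finset.sum_le_sum_of_subset_of_nonneg h fun i _ _ => M.precision_nonneg i _

lemma totalPrecision_le {σ τ : NoiseLevels K} (h : ∀ i, σ i ≤ τ i) (S : Finset (Fin K)) :
    M.totalPrecision τ S ≤ M.totalPrecision σ S :=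
  Finset.sum_le_sum fun i _ => M.precision_antitone i (h i)

lemma totalPrecision_lt (hγ : ∀ i, M.γ i ≠ 0) {σ τ : NoiseLevels K} (h : ∀ i, σ i ≤ τ i)
    {S : Finset (Fin K)} {j : Fin K} (hj : j ∈ S) (hlt : σ j < τ j) :
    M.totalPrecision τ S < M.totalPrecision σ S :=
  Finset.sum_lt_sum (fun i _ => M.precision_antitone i (h i)) ⟨j, hj, M.precision_lt (hγ j) hlt⟩

lemma totalPrecision_erase_add (σ : NoiseLevels K) {A : Finset (Fin K)} {i : Fin K} (hi : i ∈ A) :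
    M.totalPrecision σ (A.erase i) + M.precision i (σ i) = M.totalPrecision σ A :=
  Finset.sum_erase_add A _ hi

lemma totalPrecision_update_erase (σ : NoiseLevels K) (A : Finset (Fin K)) (i : Fin K) (r : ℝ≥0∞) :
    M.totalPrecision (Function.update σ i r) (A.erase i) = M.totalPrecision σ (A.erase i) :=
  Finset.sum_congr rfl fun j hj => by rw [Function.update_of_ne (Finset.ne_of_mem_erase hj)]

/-- What the data of platform `i` add to the information given by the data of the others in `A`. -/
noncomputable def marginalInfo (σ : NoiseLevels K) (A : Finset (Fin K)) (i : Fin K) : ℝ :=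
  infoOfPrecision (M.totalPrecision σ A) - infoOfPrecision (M.totalPrecision σ (A.erase i))

lemma marginalInfo_eq (σ : NoiseLevels K) {A : Finset (Fin K)} {i : Fin K} (hi : i ∈ A) :
    M.marginalInfo σ A i
      = infoOfPrecision (M.totalPrecision σ (A.erase i) + M.precision i (σ i))
        - infoOfPrecision (M.totalPrecision σ (A.erase i)) := by
  rw [totalPrecision_erase_add _ _ hi]; rfl

lemma marginalInfo_nonneg (σ : NoiseLevels K) (A : Finset (Fin K)) (i : Fin K) :
    0 ≤ M.marginalInfo σ A i :=
  sub_nonneg.2 (infoOfPrecision_le (M.totalPrecision_nonneg _ _)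
    (M.totalPrecision_le_of_subset σ (Finset.erase_subset i A)))

lemma marginalInfo_pos {σ : NoiseLevels K} {A : Finset (Fin K)} {i : Fin K} (hi : i ∈ A)
    (h : 0 < M.precision i (σ i)) : 0 < M.marginalInfo σ A i := by
  rw [M.marginalInfo_eq σ hi]
  exact sub_pos.2 (infoOfPrecision_lt (M.totalPrecision_nonneg _ _) (by linarith))

lemma marginalInfo_eq_zero {σ : NoiseLevels K} {A : Finset (Fin K)} {i : Fin K} (hi : i ∈ A)
    (h : M.precision i (σ i) = 0) : M.marginalInfo σ A i = 0 := by
  rw [M.marginalInfo_eq σ hi, h]; simp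

lemma marginalInfo_le_precision {σ : NoiseLevels K} {A : Finset (Fin K)} {i : Fin K} (hi : i ∈ A) :
    M.marginalInfo σ A i ≤ M.precision i (σ i) := by
  rw [M.marginalInfo_eq σ hi]
  have h0 := M.precision_nonneg i (σ i)
  have h := infoOfPrecision_add_sub_le le_rfl (M.totalPrecision_nonneg σ (A.erase i)) h0
  rw [zero_add, infoOfPrecision_zero, sub_zero] at h
  exact h.trans (infoOfPrecision_le_self h0)

/-- The marginal information of a platform grows with its own precision and falls with that of
the others. -/
lemma marginalInfo_le {σ τ : NoiseLevels K} {A B : Finset (Fin K)} {i : Fin K} (hA : i ∈ A)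
    (hB : i ∈ B) (h1 : M.totalPrecision τ (B.erase i) ≤ M.totalPrecision σ (A.erase i))
    (h2 : M.precision i (σ i) ≤ M.precision i (τ i)) :
    M.marginalInfo σ A i ≤ M.marginalInfo τ B i := by
  rw [M.marginalInfo_eq σ hA, M.marginalInfo_eq τ hB]
  have hτ := M.totalPrecision_nonneg τ (B.erase i)
  have hp := M.precision_nonneg i (σ i)
  refine (infoOfPrecision_add_sub_le hτ h1 hp).trans ?_
  gcongr
  exact infoOfPrecision_le (add_nonneg hτ hp) (by linarith)

lemma marginalInfo_update_lt {σ : NoiseLevels K} {A : Finset (Fin K)} {i : Fin K} (hA : i ∈ A)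
    {r : ℝ≥0∞} (h : M.precision i (σ i) < M.precision i r) :
    M.marginalInfo σ A i < M.marginalInfo (Function.update σ i r) A i := by
  rw [M.marginalInfo_eq σ hA, M.marginalInfo_eq _ hA, totalPrecision_update_erase,
    Function.update_self]
  have := M.totalPrecision_nonneg σ (A.erase i)
  have := M.precision_nonneg i (σ i)
  gcongr
  exact infoOfPrecision_lt (by positivity) (by linarith)

/-- The marginal contributions of several platforms add up to at most their joint contribution,
the data being substitutes. -/
lemma sum_marginalInfo_le (σ : NoiseLevels K) (A S : Finset (Fin K)) (hS : S ⊆ A) :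
    ∑ i ∈ S, M.marginalInfo σ A i
      ≤ infoOfPrecision (M.totalPrecision σ A) - infoOfPrecision (M.totalPrecision σ (A \ S)) := by
  induction S using Finset.induction_on with
  | empty => simp
  | insert i S hi ih =>
    rw [Finset.insert_subset_iff] at hS
    have hmem : i ∈ A \ S := Finset.mem_sdiff.2 ⟨hS.1, hi⟩
    have h : M.marginalInfo σ A i ≤ M.marginalInfo σ (A \ S) i :=
      M.marginalInfo_le hS.1 hmem (M.totalPrecision_le_of_subset σ
        (Finset.erase_subset_erase i Finset.sdiff_subset)) le_rfl
    rw [Finset.sum_insert hi, Finset.sdiff_insert]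
    have := ih hS.2
    simp only [marginalInfo] at h this ⊢
    linarith

/-! ### The pricing and purchase stages -/

/-- The user's utility from sharing with the platforms in `A` when the buyer obtains all the
informative data of `A`. -/
noncomputable def userValue (α : ℝ) (σ : NoiseLevels K) (A : Finset (Fin K)) : ℝ :=
  A.card / 2 - α * infoOfPrecision (M.totalPrecision σ A)

lemma buyerUtility_eq (hsub : M.Substitutes) (β : ℝ) (σ : NoiseLevels K) {E A : Finset (Fin K)}
    (hA : A ⊆ E) (p : Fin K → ℝ) (B : Finset (Fin K)) :
    M.buyerUtility β σ E A p B
      = β * infoOfPrecision (M.totalPrecision σ (A ∩ B)) - ∑ i ∈ A ∩ B, p i := by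
  rw [buyerUtility, Finset.inter_eq_right.2 hA, M.buyerInfo_eq hsub]

lemma userUtility_eq (hsub : M.Substitutes) (α : ℝ) (σ : NoiseLevels K) {E A : Finset (Fin K)}
    (hA : A ⊆ E) (B : Finset (Fin K)) :
    M.userUtility α σ E A B
      = A.card / 2 - α * infoOfPrecision (M.totalPrecision σ (A ∩ B)) := by
  rw [userUtility, Finset.inter_eq_right.2 hA, M.buyerInfo_eq hsub]
  simp [platformInfo_eq, div_eq_mul_inv]

variable {M} {s : StrategyProfile K} {α β : ℝ} {m : NoiseLevels K}

namespace IsEquilibrium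

/-- Because the data are substitutes, the buyer purchases any data priced below their marginal
value, whatever the other prices are. -/
lemma mem_buy (h : M.IsEquilibrium s α β m) (hsub : M.Substitutes) (hβ : 0 < β)
    {σ : NoiseLevels K} (hσ : ∀ i, Allowed (m i) (σ i)) {E A : Finset (Fin K)} (hA : A ⊆ E)
    {i : Fin K} (hi : i ∈ A) {p : Fin K → ℝ} (hp : p i < β * M.marginalInfo σ A i) :
    i ∈ s.buy σ E A p := by
  by_contra hB
  have h1 := h.buyer σ hσ E A hA p (insert i (s.buy σ E A p))
  rw [M.buyerUtility_eq hsub _ _ hA, M.buyerUtility_eq hsub _ _ hA,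
    Finset.inter_insert_of_mem hi] at h1
  set T := A ∩ s.buy σ E A p
  have hT : i ∉ T := fun hT => hB (Finset.mem_inter.1 hT).2
  have h2 : M.marginalInfo σ A i ≤ M.marginalInfo σ (insert i T) i :=
    M.marginalInfo_le hi (Finset.mem_insert_self i T) (M.totalPrecision_le_of_subset σ
      (Finset.erase_subset_erase i (Finset.insert_subset hi Finset.inter_subset_left))) le_rfl
  rw [marginalInfo, marginalInfo, Finset.erase_insert hT] at h2
  rw [Finset.sum_insert hT] at h1
  rw [marginalInfo] at hp
  have := mul_le_mul_of_nonneg_left h2 hβ.le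
  linarith

/-- All informative data are sold. -/
lemma mem_buy_price (h : M.IsEquilibrium s α β m) (hsub : M.Substitutes) (hβ : 0 < β)
    {σ : NoiseLevels K} (hσ : ∀ i, Allowed (m i) (σ i)) {E A : Finset (Fin K)} (hA : A ⊆ E)
    {i : Fin K} (hi : i ∈ A) (hpos : 0 < M.precision i (σ i)) :
    i ∈ s.buy σ E A (s.price σ E A) := by
  by_contra hB
  have hm : 0 < β * M.marginalInfo σ A i := mul_pos hβ (M.marginalInfo_pos hi hpos)
  have h1 := h.pricing σ hσ E A hA i (β * M.marginalInfo σ A i / 2)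
  have h2 := h.mem_buy hsub hβ hσ hA hi
    (p := Function.update (s.price σ E A) i (β * M.marginalInfo σ A i / 2))
    (by rw [Function.update_self]; linarith)
  simp only [platformUtility, hA hi, hi, hB, h2, Finset.mem_inter, Function.update_self, if_true,
    and_self, and_false, if_false] at h1
  linarith

lemma totalPrecision_inter_buy (h : M.IsEquilibrium s α β m) (hsub : M.Substitutes) (hβ : 0 < β)
    {σ : NoiseLevels K} (hσ : ∀ i, Allowed (m i) (σ i)) {E A : Finset (Fin K)} (hA : A ⊆ E)
    {A' : Finset (Fin K)} (hA' : A' ⊆ A) :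
    M.totalPrecision σ (A' ∩ s.buy σ E A (s.price σ E A)) = M.totalPrecision σ A' := by
  refine Finset.sum_subset Finset.inter_subset_left fun i hi hni => ?_
  by_contra hne
  exact hni (Finset.mem_inter.2 ⟨hi, h.mem_buy_price hsub hβ hσ hA (hA' hi)
    (lt_of_le_of_ne (M.precision_nonneg i _) (Ne.symm hne))⟩)

/-- Every platform with data sells at the marginal value of its data for the buyer. -/
lemma revenue_eq (h : M.IsEquilibrium s α β m) (hsub : M.Substitutes) (hβ : 0 < β)
    {σ : NoiseLevels K} (hσ : ∀ i, Allowed (m i) (σ i)) {E A : Finset (Fin K)} (hA : A ⊆ E)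
    {i : Fin K} (hi : i ∈ A) :
    (if i ∈ s.buy σ E A (s.price σ E A) then s.price σ E A i else 0)
      = β * M.marginalInfo σ A i := by
  split_ifs with hB
  · refine le_antisymm ?_ ?_
    · -- otherwise the buyer would drop platform `i`
      have h1 := h.buyer σ hσ E A hA (s.price σ E A) ((s.buy σ E A (s.price σ E A)).erase i)
      rw [M.buyerUtility_eq hsub _ _ hA, M.buyerUtility_eq hsub _ _ hA,
        h.totalPrecision_inter_buy hsub hβ hσ hA subset_rfl, Finset.inter_erase,
        ← Finset.erase_inter,
        h.totalPrecision_inter_buy hsub hβ hσ hA (Finset.erase_subset i A), Finset.erase_inter,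
        ← Finset.sum_erase_add (A ∩ s.buy σ E A (s.price σ E A)) _
          (Finset.mem_inter.2 ⟨hi, hB⟩)] at h1
      rw [marginalInfo]
      linarith
    · -- otherwise platform `i` would raise its price
      by_contra! hlt
      have h1 := h.pricing σ hσ E A hA i ((s.price σ E A i + β * M.marginalInfo σ A i) / 2)
      have h2 := h.mem_buy hsub hβ hσ hA hi (p := Function.update (s.price σ E A) i
          ((s.price σ E A i + β * M.marginalInfo σ A i) / 2))
        (by rw [Function.update_self]; linarith)
      simp only [platformUtility, hA hi, hi, hB, h2, Finset.mem_inter, Function.update_self,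
        if_true, and_self] at h1
      linarith
  · have hz : M.precision i (σ i) = 0 := by
      by_contra hne
      exact hB (h.mem_buy_price hsub hβ hσ hA hi
        (lt_of_le_of_ne (M.precision_nonneg i _) (Ne.symm hne)))
    rw [M.marginalInfo_eq_zero hi hz, mul_zero]

lemma userContinuation_eq (h : M.IsEquilibrium s α β m) (hsub : M.Substitutes) (hβ : 0 < β)
    {σ : NoiseLevels K} (hσ : ∀ i, Allowed (m i) (σ i)) {E A : Finset (Fin K)} (hA : A ⊆ E) :
    M.userContinuation s α σ E A = M.userValue α σ A := by
  rw [userContinuation, M.userUtility_eq hsub _ _ hA,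
    h.totalPrecision_inter_buy hsub hβ hσ hA subset_rfl, userValue]

lemma share_subset (h : M.IsEquilibrium s α β m) {σ : NoiseLevels K}
    (hσ : ∀ i, Allowed (m i) (σ i)) (E : Finset (Fin K)) : s.share σ E ⊆ E :=
  (h.sharing σ hσ E).1.1

lemma userValue_le_share (h : M.IsEquilibrium s α β m) (hsub : M.Substitutes) (hβ : 0 < β)
    {σ : NoiseLevels K} (hσ : ∀ i, Allowed (m i) (σ i)) {E A : Finset (Fin K)} (hA : A ⊆ E) :
    M.userValue α σ A ≤ M.userValue α σ (s.share σ E) := by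
  rw [← h.userContinuation_eq hsub hβ hσ hA,
    ← h.userContinuation_eq hsub hβ hσ (h.share_subset hσ E)]
  exact (h.sharing σ hσ E).1.2 A hA

lemma platformContinuation_of_mem (h : M.IsEquilibrium s α β m) (hsub : M.Substitutes)
    (hβ : 0 < β) {σ : NoiseLevels K} (hσ : ∀ i, Allowed (m i) (σ i)) {E : Finset (Fin K)}
    {i : Fin K} (hi : i ∈ s.share σ E) :
    M.platformContinuation s i σ E
      = 1 / 2 + β * M.marginalInfo σ (s.share σ E) i - M.c i := by
  have hE := h.share_subset hσ E
  rw [← h.revenue_eq hsub hβ hσ hE hi]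
  simp [platformContinuation, platformUtility, hE hi, hi, platformInfo_eq]

lemma userPayoff_eq (h : M.IsEquilibrium s α β m) (hsub : M.Substitutes) (hβ : 0 < β) :
    M.userPayoff s α = M.userValue α s.noise (s.share s.noise s.entry) :=
  h.userContinuation_eq hsub hβ h.allowed (h.share_subset h.allowed _)

end IsEquilibrium

lemma platformContinuation_of_notMem {i : Fin K} {σ : NoiseLevels K} {E : Finset (Fin K)}
    (hi : i ∉ E) : M.platformContinuation s i σ E = 0 := by
  simp [platformContinuation, platformUtility, hi]

end Market

namespace Market

variable {d K : ℕ} {M : Market d K} {s : StrategyProfile K} {α β : ℝ} {m : NoiseLevels K}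

/-! ### Mandates under which the user shares with everybody -/

lemma allowed_self (r : ℝ≥0∞) : Allowed r r := ⟨le_rfl, id⟩

lemma allowed_update {σ : NoiseLevels K} (hσ : ∀ i, Allowed (m i) (σ i)) {i : Fin K} {r : ℝ≥0∞}
    (hr : Allowed (m i) r) (j : Fin K) : Allowed (m j) (Function.update σ i r j) := by
  rcases eq_or_ne j i with rfl | h
  · rwa [Function.update_self]
  · rw [Function.update_of_ne h]; exact hσ j

/-- If the mandate makes all the data together cost the user less than the benefit `1/2` from one
platform, then she prefers sharing with more platforms. -/
lemma userValue_lt_of_ssubset (hα : 0 ≤ α)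
    (hsmall : α * infoOfPrecision (M.totalPrecision m Finset.univ) < 1 / 2)
    {σ : NoiseLevels K} (hσ : ∀ i, m i ≤ σ i) {A E : Finset (Fin K)} (h : A ⊂ E) :
    M.userValue α σ A < M.userValue α σ E := by
  have hc : (A.card : ℝ) + 1 ≤ E.card := by exact_mod_cast Finset.card_lt_card h
  have h1 : infoOfPrecision (M.totalPrecision σ E)
      ≤ infoOfPrecision (M.totalPrecision m Finset.univ) :=
    infoOfPrecision_le (M.totalPrecision_nonneg _ _)
      ((M.totalPrecision_le_of_subset σ (Finset.subset_univ E)).trans (M.totalPrecision_le hσ _))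
  have h2 := infoOfPrecision_nonneg (M.totalPrecision_nonneg σ A)
  have h3 := mul_le_mul_of_nonneg_left h1 hα
  have h4 := mul_nonneg hα h2
  simp only [userValue]
  linarith

/-- At prices equal to the marginal values of the data, purchasing everything is optimal. -/
lemma buyerUtility_marginal_le (hsub : M.Substitutes) (hβ : 0 ≤ β) (σ : NoiseLevels K)
    {E A : Finset (Fin K)} (hA : A ⊆ E) (B : Finset (Fin K)) :
    M.buyerUtility β σ E A (fun i => β * M.marginalInfo σ A i) B
      ≤ M.buyerUtility β σ E A (fun i => β * M.marginalInfo σ A i) A := by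
  rw [M.buyerUtility_eq hsub _ _ hA, M.buyerUtility_eq hsub _ _ hA, Finset.inter_self,
    ← Finset.sum_sdiff (Finset.inter_subset_left : A ∩ B ⊆ A), ← Finset.mul_sum]
  have h := M.sum_marginalInfo_le σ A (A \ (A ∩ B)) Finset.sdiff_subset
  rw [Finset.sdiff_sdiff_eq_self Finset.inter_subset_left] at h
  have := mul_le_mul_of_nonneg_left h hβ
  rw [Finset.mul_sum] at this
  linarith

/-- If the other prices equal the marginal values of the data, then the buyer purchases the data of
platform `i` only at a price of at most their marginal value. -/
lemma price_le_of_mem_optimal (hsub : M.Substitutes) (hβ : 0 ≤ β) {σ : NoiseLevels K}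
    {E A : Finset (Fin K)} (hA : A ⊆ E) {i : Fin K} (hi : i ∈ A) {q : ℝ} {B : Finset (Fin K)}
    (hB : ∀ B', M.buyerUtility β σ E A
        (Function.update (fun j => β * M.marginalInfo σ A j) i q) B'
      ≤ M.buyerUtility β σ E A (Function.update (fun j => β * M.marginalInfo σ A j) i q) B)
    (hiB : i ∈ B) : q ≤ β * M.marginalInfo σ A i := by
  have h1 := hB (A.erase i)
  have h2 := buyerUtility_marginal_le hsub hβ σ hA B
  have hiT : i ∈ A ∩ B := Finset.mem_inter.2 ⟨hi, hiB⟩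
  rw [M.buyerUtility_eq hsub _ _ hA, M.buyerUtility_eq hsub _ _ hA,
    Finset.inter_eq_right.2 (Finset.erase_subset i A),
    Finset.sum_update_of_notMem (Finset.notMem_erase i A),
    Finset.sum_update_of_mem hiT, Finset.sdiff_singleton_eq_erase] at h1
  rw [M.buyerUtility_eq hsub _ _ hA, M.buyerUtility_eq hsub _ _ hA, Finset.inter_self,
    ← Finset.sum_erase_add (A ∩ B) _ hiT, ← Finset.sum_erase_add A _ hi] at h2
  simp only [marginalInfo] at *
  linarith

/-- Under such a mandate, if every platform recovers its cost when all of them sell data with the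
lowest noise levels allowed, then this is an equilibrium outcome. -/
lemma exists_isEquilibrium (hsub : M.Substitutes) (hα : 0 ≤ α) (hβ : 0 ≤ β)
    (hsmall : α * infoOfPrecision (M.totalPrecision m Finset.univ) < 1 / 2)
    (hviable : ∀ i, M.c i - 1 / 2 ≤ β * M.marginalInfo m Finset.univ i) :
    ∃ s, M.IsEquilibrium s α β m ∧ M.userPayoff s α = M.userValue α m Finset.univ := by
  classical
  -- an optimal purchase, which is `A` whenever `A` is optimal
  have hbest : ∀ (σ : NoiseLevels K) (E A : Finset (Fin K)) (p : Fin K → ℝ),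
      ∃ B, (∀ B', M.buyerUtility β σ E A p B' ≤ M.buyerUtility β σ E A p B) ∧
        ((∀ B', M.buyerUtility β σ E A p B' ≤ M.buyerUtility β σ E A p A) → B = A) := by
    intro σ E A p
    by_cases h : ∀ B', M.buyerUtility β σ E A p B' ≤ M.buyerUtility β σ E A p A
    · exact ⟨A, h, fun _ => rfl⟩
    · obtain ⟨B, hB⟩ := Finite.exists_max (M.buyerUtility β σ E A p)
      exact ⟨B, hB, fun h' => absurd h' h⟩
  choose buy hbuy hbuyA using hbest
  set price : NoiseLevels K → Finset (Fin K) → Finset (Fin K) → Fin K → ℝ :=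
    fun σ _ A i => β * M.marginalInfo σ A i with hprice
  have hall : ∀ σ {E A : Finset (Fin K)}, A ⊆ E → buy σ E A (price σ E A) = A :=
    fun σ E A hA => hbuyA σ E A _ (buyerUtility_marginal_le hsub hβ σ hA)
  set s : StrategyProfile K := ⟨m, Finset.univ, fun _ E => E, price, buy⟩ with hs
  have hcont : ∀ σ {E A : Finset (Fin K)}, A ⊆ E →
      M.userContinuation s α σ E A = M.userValue α σ A := fun σ E A hA => by
    simp only [userContinuation, hs]
    rw [hall σ hA, M.userUtility_eq hsub _ _ hA, Finset.inter_self, userValue]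
  have hplat : ∀ σ {E : Finset (Fin K)} {i}, i ∈ E → M.platformContinuation s i σ E
      = 1 / 2 + β * M.marginalInfo σ E i - M.c i := fun σ E i hi => by
    simp only [platformContinuation, hs]
    rw [hall σ subset_rfl]
    simp [platformUtility, hi, platformInfo_eq, hprice]
  refine ⟨s, ⟨fun i => allowed_self _, fun σ _ E A _ p => hbuy σ E A p, ?_, ?_, ?_⟩,
    hcont m subset_rfl⟩
  · intro σ _ E A hA i q
    simp only [hs]
    rw [hall σ hA]
    by_cases hi : i ∈ A
    · have h0 := mul_nonneg hβ (M.marginalInfo_nonneg σ A i)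
      by_cases hB : i ∈ buy σ E A (Function.update (price σ E A) i q)
      · have := price_le_of_mem_optimal hsub hβ hA hi (hbuy σ E A _) hB
        simpa [platformUtility, hA hi, hi, hB] using this
      · simpa [platformUtility, hA hi, hi, hB] using h0
    · simp [platformUtility, hi]
  · intro σ hσ E
    refine ⟨⟨subset_rfl, fun A hA => ?_⟩, fun A hA => hA.1⟩
    rw [hcont σ hA, hcont σ subset_rfl]
    rcases hA.eq_or_ssubset with rfl | hA
    · rfl
    · exact (userValue_lt_of_ssubset hα hsmall (fun i => (hσ i).1) hA).le
  · intro i r hr E hE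
    rw [show M.platformContinuation s i s.noise s.entry = _ from hplat m (Finset.mem_univ i)]
    by_cases hi : i ∈ E
    · have hEu : E = Finset.univ := by
        ext j
        rcases eq_or_ne j i with rfl | hj
        · simp [hi]
        · simp [hE j hj, hs]
      subst hEu
      rw [hplat _ hi]
      have h1 : M.marginalInfo (Function.update m i r) Finset.univ i
          ≤ M.marginalInfo m Finset.univ i :=
        M.marginalInfo_le hi hi (M.totalPrecision_update_erase m _ i r).ge
          (by rw [Function.update_self]; exact M.precision_antitone i hr.1)
      have := mul_le_mul_of_nonneg_left h1 hβ
      simp only [hs]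
      linarith
    · rw [platformContinuation_of_notMem hi]
      linarith [hviable i]

namespace IsEquilibrium

/-- If, in addition, every platform makes a strict profit when all sell data with the lowest noise
levels allowed, then entering at the lowest noise level is dominant, so that all equilibria give
the user the same utility. -/
lemma userPayoff_eq_of_small (h : M.IsEquilibrium s α β m) (hsub : M.Substitutes)
    (hγ : ∀ i, M.γ i ≠ 0) (hα : 0 ≤ α) (hβ : 0 < β)
    (hsmall : α * infoOfPrecision (M.totalPrecision m Finset.univ) < 1 / 2)
    (hviable : ∀ i, M.c i - 1 / 2 < β * M.marginalInfo m Finset.univ i) :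
    M.userPayoff s α = M.userValue α m Finset.univ := by
  have hshare : ∀ σ : NoiseLevels K, (∀ i, Allowed (m i) (σ i)) → ∀ E, s.share σ E = E := by
    intro σ hσ E
    by_contra hne
    have h1 := h.userValue_le_share hsub hβ hσ (subset_refl E)
    have h2 := userValue_lt_of_ssubset hα hsmall (fun i => (hσ i).1)
      ((h.share_subset hσ E).ssubset_of_ne hne)
    linarith
  have hplat : ∀ σ : NoiseLevels K, (∀ i, Allowed (m i) (σ i)) → ∀ {E i}, i ∈ E →
      M.platformContinuation s i σ E = 1 / 2 + β * M.marginalInfo σ E i - M.c i := by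
    intro σ hσ E i hi
    have := h.platformContinuation_of_mem hsub hβ hσ (E := E) (i := i) (by rwa [hshare σ hσ])
    rwa [hshare σ hσ] at this
  have hdev : ∀ i, ∀ j, Allowed (m j) (Function.update s.noise i (m i) j) := fun i =>
    allowed_update h.allowed (allowed_self _)
  have hentry : s.entry = Finset.univ := by
    refine Finset.eq_univ_iff_forall.2 fun i => ?_
    by_contra hi
    have h1 := h.platforms i (m i) (allowed_self _) (insert i s.entry) (fun j hj => by simp [hj])
    rw [platformContinuation_of_notMem hi,
      hplat _ (hdev i) (Finset.mem_insert_self i _)] at h1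
    have h2 : M.marginalInfo m Finset.univ i
        ≤ M.marginalInfo (Function.update s.noise i (m i)) (insert i s.entry) i := by
      refine M.marginalInfo_le (Finset.mem_univ i) (Finset.mem_insert_self i _) ?_
        (by rw [Function.update_self])
      exact (M.totalPrecision_le_of_subset _ (Finset.erase_subset_erase i
        (Finset.subset_univ _))).trans (M.totalPrecision_le (fun j => (hdev i j).1) _)
    have := mul_le_mul_of_nonneg_left h2 hβ.le
    linarith [hviable i]
  have hnoise : s.noise = m := by
    funext i
    by_contra hne
    have hlt : m i < s.noise i := lt_of_le_of_ne (h.allowed i).1 (Ne.symm hne)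
    have h1 := h.platforms i (m i) (allowed_self _) s.entry (fun j _ => Iff.rfl)
    have hi : i ∈ s.entry := hentry ▸ Finset.mem_univ i
    rw [hplat _ (hdev i) hi, hplat _ h.allowed hi] at h1
    have := mul_lt_mul_of_pos_left
      (M.marginalInfo_update_lt hi (M.precision_lt (hγ i) hlt)) hβ
    linarith
  rw [h.userPayoff_eq hsub hβ, hshare _ h.allowed, hnoise, hentry]

end IsEquilibrium

/-! ### Equilibria with a high user utility -/

lemma eq_univ_of_lt_userValue (hα : 0 ≤ α) {σ : NoiseLevels K} {A : Finset (Fin K)}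
    (h : ((K : ℝ) - 1) / 2 < M.userValue α σ A) : A = Finset.univ := by
  have h1 := mul_nonneg hα (infoOfPrecision_nonneg (M.totalPrecision_nonneg σ A))
  rw [userValue] at h
  have h2 : (K : ℝ) < A.card + 1 := by linarith
  have h3 : K < A.card + 1 := by exact_mod_cast h2
  refine Finset.eq_univ_of_card A (le_antisymm (Finset.card_le_univ A) ?_)
  rw [Fintype.card_fin]; omega

lemma continuous_infoOfPrecision_totalPrecision {σ : ℝ≥0 → NoiseLevels K}
    (hσ : ∀ i, Continuous fun r => M.precision i (σ r i)) (A : Finset (Fin K)) :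
    Continuous fun r => infoOfPrecision (M.totalPrecision (σ r) A) := by
  have h1 : Continuous fun r => M.totalPrecision (σ r) A :=
    continuous_finsetSum A fun j _ => hσ j
  have h2 : ∀ r, 1 + M.totalPrecision (σ r) A ≠ 0 := fun r => by
    have := M.totalPrecision_nonneg (σ r) A
    positivity
  unfold infoOfPrecision
  exact continuous_const.sub ((continuous_const.add h1).inv₀ h2)

lemma continuous_userValue_update (α : ℝ) (σ : NoiseLevels K) (A : Finset (Fin K)) (i : Fin K) :
    Continuous fun r : ℝ≥0 => M.userValue α (Function.update σ i (r : ℝ≥0∞)) A := by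
  unfold userValue
  refine continuous_const.sub (continuous_const.mul
    (continuous_infoOfPrecision_totalPrecision (fun j => ?_) A))
  rcases eq_or_ne j i with rfl | hj
  · simpa using M.continuous_precision_coe j
  · simpa [Function.update_of_ne hj] using continuous_const

namespace IsEquilibrium

/-- A utility above `(K - 1) / 2` requires that the user strictly prefers sharing with everybody.
Then every platform enters, and none adds more noise than the mandate requires, because adding
slightly less noise would raise its price without losing it the data. -/
lemma of_lt_userPayoff (h : M.IsEquilibrium s α β m) (hsub : M.Substitutes)
    (hγ : ∀ i, M.γ i ≠ 0) (hα : 0 ≤ α) (hβ : 0 < β)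
    (hhigh : ((K : ℝ) - 1) / 2 < M.userPayoff s α) :
    M.userPayoff s α = M.userValue α m Finset.univ ∧
      ∀ i, M.c i - 1 / 2 ≤ β * M.marginalInfo m Finset.univ i := by
  have hpay := h.userPayoff_eq hsub hβ
  rw [hpay] at hhigh ⊢
  have hshare := eq_univ_of_lt_userValue hα hhigh
  have hentry : s.entry = Finset.univ :=
    Finset.univ_subset_iff.1 (hshare ▸ h.share_subset h.allowed s.entry)
  rw [hshare] at hhigh ⊢
  have hplat : ∀ i, M.platformContinuation s i s.noise s.entry
      = 1 / 2 + β * M.marginalInfo s.noise Finset.univ i - M.c i := fun i => by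
    rw [h.platformContinuation_of_mem hsub hβ h.allowed (by simp [hshare]), hshare]
  have hnoise : s.noise = m := by
    funext i
    by_contra hne
    have hlt : m i < s.noise i := lt_of_le_of_ne (h.allowed i).1 (Ne.symm hne)
    have hmtop : m i ≠ ⊤ := hlt.ne_top
    have htop : s.noise i ≠ ⊤ := fun ht => hmtop ((h.allowed i).2 ht)
    obtain ⟨n₀, hn₀⟩ := (⟨_, ENNReal.coe_toNNReal hmtop⟩ : ∃ a : ℝ≥0, (a : ℝ≥0∞) = m i)
    obtain ⟨n, hn⟩ := (⟨_, ENNReal.coe_toNNReal htop⟩ : ∃ a : ℝ≥0, (a : ℝ≥0∞) = s.noise i)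
    rw [← hn₀, ← hn, ENNReal.coe_lt_coe] at hlt
    have hev : ∀ᶠ r : ℝ≥0 in nhdsWithin n (Set.Iio n),
        ((K : ℝ) - 1) / 2 < M.userValue α (Function.update s.noise i (r : ℝ≥0∞)) Finset.univ := by
      refine ((continuous_userValue_update α s.noise Finset.univ i).tendsto n |>.mono_left
        nhdsWithin_le_nhds).eventually_const_lt ?_
      rwa [hn, Function.update_eq_self]
    have : (nhdsWithin n (Set.Iio n)).NeBot := nhdsLT_neBot_of_exists_lt ⟨n₀, hlt⟩
    obtain ⟨r, hr1, hr2, hr3⟩ := (hev.and ((eventually_nhdsWithin_of_eventually_nhds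
      (eventually_gt_nhds hlt)).and self_mem_nhdsWithin)).exists
    have hr3 : r < n := hr3
    have hallow : Allowed (m i) r :=
      ⟨by rw [← hn₀]; exact_mod_cast hr2.le, fun ht => absurd ht ENNReal.coe_ne_top⟩
    have hσ := allowed_update h.allowed hallow
    have hshare' : s.share (Function.update s.noise i (r : ℝ≥0∞)) s.entry = Finset.univ :=
      eq_univ_of_lt_userValue hα
        (hr1.trans_le (h.userValue_le_share hsub hβ hσ (by rw [hentry])))
    have h1 := h.platforms i r hallow s.entry (fun j _ => Iff.rfl)
    rw [hplat, h.platformContinuation_of_mem hsub hβ hσ (by simp [hshare']), hshare'] at h1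
    have h2 := mul_lt_mul_of_pos_left (M.marginalInfo_update_lt (Finset.mem_univ i)
      (M.precision_lt (hγ i) (show (r : ℝ≥0∞) < s.noise i by rw [← hn]; exact_mod_cast hr3))) hβ
    linarith
  rw [hnoise]
  refine ⟨rfl, fun i => ?_⟩
  have h1 := h.platforms i (s.noise i) (h.allowed i) (s.entry.erase i)
    (fun j hj => by simp [hj])
  rw [hplat, platformContinuation_of_notMem (Finset.notMem_erase i _), hnoise] at h1
  linarith

end IsEquilibrium

end Market

namespace Market

variable {d K : ℕ} {M : Market d K} {α β : ℝ}

/-! ### The largest noise level at which all platforms enter -/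

/-- A mandate under which every platform recovers its cost when all platforms sell data with the
lowest noise levels allowed. -/
def Viable (M : Market d K) (β : ℝ) (m : NoiseLevels K) : Prop :=
  ∀ i, M.c i - 1 / 2 ≤ β * M.marginalInfo m Finset.univ i

lemma Viable.ne_top {m : NoiseLevels K} (h : M.Viable β m) {i : Fin K} (hi : M.IsHighCost i) :
    m i ≠ ⊤ := by
  intro ht
  have := h i
  rw [M.marginalInfo_eq_zero (Finset.mem_univ i) (by rw [ht, precision_top]), mul_zero] at this
  rw [IsHighCost] at hi
  linarith

/-- In a family of mandates that either bans a platform or imposes on it the common level `r`, the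
viable levels `r` have a maximum: they form a closed set, which is bounded because a high-cost
platform can only recover its cost if its data are precise enough. -/
lemma exists_isGreatest_viable (hhigh : ∃ i, M.IsHighCost i) (hβ : 0 ≤ β)
    {σ : ℝ≥0 → NoiseLevels K} (hσ : ∀ i, (∀ r, σ r i = ⊤) ∨ ∀ r, σ r i = (r : ℝ≥0∞))
    {r₀ : ℝ≥0} (hr₀ : M.Viable β (σ r₀)) : ∃ R, IsGreatest {r | M.Viable β (σ r)} R := by
  obtain ⟨h, hh⟩ := hhigh
  have hcont : ∀ i, Continuous fun r => M.precision i (σ r i) := fun i => by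
    rcases hσ i with h | h
    · simpa [h] using continuous_const
    · simpa [h] using M.continuous_precision_coe i
  have hclosed : IsClosed {r | M.Viable β (σ r)} := by
    simp only [Viable, Set.ofPred_forall]
    exact isClosed_iInter fun i => isClosed_le continuous_const <| continuous_const.mul <|
      (continuous_infoOfPrecision_totalPrecision hcont _).sub
        (continuous_infoOfPrecision_totalPrecision hcont _)
  have hδ : 0 < M.c h - 1 / 2 := sub_pos.2 hh
  have hbdd : {r | M.Viable β (σ r)} ⊆ Set.Icc 0 (β / (M.c h - 1 / 2) + 1).toNNReal := by
    intro r hr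
    refine ⟨zero_le, ?_⟩
    rw [← NNReal.coe_le_coe, Real.coe_toNNReal _ (by positivity)]
    have hrh : σ r h = r := (hσ h).resolve_left (fun h' => hr.ne_top hh (h' r)) r
    have h1 := M.marginalInfo_le_precision (σ := σ r) (Finset.mem_univ h)
    rw [hrh] at h1
    have h2 := M.precision_mul_sq_le_one h r
    have h3 : (M.c h - 1 / 2) * (r : ℝ) ^ 2 ≤ β := by
      calc (M.c h - 1 / 2) * (r : ℝ) ^ 2
          ≤ β * M.precision h r * (r : ℝ) ^ 2 := by
            gcongr
            exact (hr h).trans (mul_le_mul_of_nonneg_left h1 hβ)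
        _ = β * (M.precision h r * (r : ℝ) ^ 2) := by ring
        _ ≤ β := mul_le_of_le_one_right hβ h2
    have h4 : (r : ℝ) ^ 2 ≤ β / (M.c h - 1 / 2) := by
      rw [le_div_iff₀ hδ]; linarith
    nlinarith [sq_nonneg ((r : ℝ) - 1)]
  exact (isCompact_Icc.of_isClosed_subset hclosed hbdd).exists_isGreatest ⟨r₀, hr₀⟩

lemma exists_small_uniform (M : Market d K) (hα : 0 ≤ α) : ∃ r : ℝ≥0,
    α * infoOfPrecision (M.totalPrecision (fun _ => (r : ℝ≥0∞)) Finset.univ) < 1 / 2 := by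
  refine ⟨(2 * α * K + 1).toNNReal, ?_⟩
  set r := (2 * α * K + 1).toNNReal
  have hr : (r : ℝ) = 2 * α * K + 1 := Real.coe_toNNReal _ (by positivity)
  have hnn : 0 ≤ α * K := by positivity
  have h1 : M.totalPrecision (fun _ => (r : ℝ≥0∞)) Finset.univ * (r : ℝ) ^ 2 ≤ K := by
    rw [totalPrecision, Finset.sum_mul]
    calc _ ≤ ∑ _i : Fin K, (1 : ℝ) := Finset.sum_le_sum fun i _ => M.precision_mul_sq_le_one i r
      _ = K := by simp
  have h2 := infoOfPrecision_le_self (M.totalPrecision_nonneg (fun _ => (r : ℝ≥0∞)) Finset.univ)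
  have h3 := mul_le_mul_of_nonneg_left h2 hα
  have h4 := mul_le_mul_of_nonneg_left h1 hα
  have h5 : (0 : ℝ) < (r : ℝ) ^ 2 := by rw [hr]; positivity
  refine h3.trans_lt (lt_of_mul_lt_mul_right (a := (r : ℝ) ^ 2) ?_ h5.le)
  have h6 : (r : ℝ) ≤ (r : ℝ) ^ 2 := by rw [hr]; nlinarith
  linarith

lemma eventually_viable_uniform (hγ : ∀ i, M.γ i ≠ 0) (r : ℝ≥0) :
    ∀ᶠ β : ℝ in Filter.atTop, M.Viable β fun _ => (r : ℝ≥0∞) := by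
  refine Filter.eventually_all.2 fun i => ?_
  have h : 0 < M.marginalInfo (fun _ => (r : ℝ≥0∞)) Finset.univ i :=
    M.marginalInfo_pos (Finset.mem_univ i) (M.precision_pos (hγ i) ENNReal.coe_ne_top)
  exact (Filter.tendsto_id.atTop_mul_const h).eventually_ge_atTop _

/-- A user who needs privacy is exposed to every platform: data independent of `yᵀθ` would always
be shared. -/
lemma RequiresPrivacy.γ_ne_zero (hsub : M.Substitutes) (h : M.RequiresPrivacy α) (i : Fin K) :
    M.γ i ≠ 0 := by
  intro h0
  have h1 := (h {i}).1.2 {i} subset_rfl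
  rw [M.userUtility_eq hsub _ _ subset_rfl, M.userUtility_eq hsub _ _ (Finset.empty_subset _)] at h1
  simp [totalPrecision, precision, h0, infoOfPrecision_zero] at h1
  norm_num at h1

/-! ### Comparing mandates -/

lemma banLowCost_of_isLowCost {i : Fin K} (hi : M.IsLowCost i) (r : ℝ≥0) :
    M.banLowCost r i = ⊤ := by simp [banLowCost, hi]

lemma banLowCost_of_isHighCost {i : Fin K} (hi : M.IsHighCost i) (r : ℝ≥0) :
    M.banLowCost r i = r := by
  have : ¬ M.IsLowCost i := fun h => lt_asymm hi h
  simp [banLowCost, this]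

lemma le_banLowCost_of_isHighCost (hcost : ∀ i, M.IsLowCost i ∨ M.IsHighCost i)
    {m : NoiseLevels K} {r : ℝ≥0} (h : ∀ i, M.IsHighCost i → m i ≤ r) (i : Fin K) :
    m i ≤ M.banLowCost r i := by
  rcases hcost i with hi | hi
  · rw [banLowCost_of_isLowCost hi]; exact le_top
  · rw [banLowCost_of_isHighCost hi]; exact h i hi

/-- Banning the low-cost platforms leaves more value to the data of the high-cost ones. -/
lemma Viable.banLowCost (hcost : ∀ i, M.IsLowCost i ∨ M.IsHighCost i) (hβ : 0 ≤ β)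
    {m : NoiseLevels K} {r : ℝ≥0} (hm : ∀ i, M.IsHighCost i → m i = r) (h : M.Viable β m) :
    M.Viable β (M.banLowCost r) := by
  intro i
  rcases hcost i with hi | hi
  · have := mul_nonneg hβ (M.marginalInfo_nonneg (M.banLowCost r) Finset.univ i)
    rw [IsLowCost] at hi
    linarith
  · refine (h i).trans (mul_le_mul_of_nonneg_left ?_ hβ)
    refine M.marginalInfo_le (Finset.mem_univ i) (Finset.mem_univ i)
      (M.totalPrecision_le (le_banLowCost_of_isHighCost hcost fun j hj => (hm j hj).le) _) ?_
    rw [hm i hi, banLowCost_of_isHighCost hi]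

/-- With a low-cost platform that sells data under `m`, banning it makes the high-cost platforms
strictly profitable. -/
lemma Viable.banLowCost_lt (hcost : ∀ i, M.IsLowCost i ∨ M.IsHighCost i) (hβ : 0 < β)
    (hγ : ∀ i, M.γ i ≠ 0) (hlow : ∃ i, M.IsLowCost i) {r : ℝ≥0}
    (h : M.Viable β fun _ => (r : ℝ≥0∞)) (i : Fin K) :
    M.c i - 1 / 2 < β * M.marginalInfo (M.banLowCost r) Finset.univ i := by
  rcases hcost i with hi | hi
  · have := mul_nonneg hβ.le (M.marginalInfo_nonneg (M.banLowCost r) Finset.univ i)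
    rw [IsLowCost] at hi
    linarith
  · obtain ⟨j, hj⟩ := hlow
    have hji : j ≠ i := fun e => lt_asymm hi (e ▸ hj)
    refine (h i).trans_lt (mul_lt_mul_of_pos_left ?_ hβ)
    rw [M.marginalInfo_eq _ (Finset.mem_univ i), M.marginalInfo_eq _ (Finset.mem_univ i),
      banLowCost_of_isHighCost hi]
    refine infoOfPrecision_add_sub_lt (M.totalPrecision_nonneg _ _) ?_
      (M.precision_pos (hγ i) ENNReal.coe_ne_top)
    refine M.totalPrecision_lt hγ (le_banLowCost_of_isHighCost hcost fun _ _ => le_rfl)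
      (Finset.mem_erase.2 ⟨hji, Finset.mem_univ j⟩) ?_
    rw [banLowCost_of_isLowCost hj]
    exact ENNReal.coe_lt_top

lemma userValue_le_userValue (hα : 0 ≤ α) {σ τ : NoiseLevels K} (h : ∀ i, σ i ≤ τ i)
    (A : Finset (Fin K)) : M.userValue α σ A ≤ M.userValue α τ A :=
  sub_le_sub_left (mul_le_mul_of_nonneg_left
    (infoOfPrecision_le (M.totalPrecision_nonneg _ _) (M.totalPrecision_le h A)) hα) _

lemma userValue_lt_userValue (hγ : ∀ i, M.γ i ≠ 0) (hα : 0 < α) {σ τ : NoiseLevels K}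
    (h : ∀ i, σ i ≤ τ i) {j : Fin K} (hj : σ j < τ j) :
    M.userValue α σ Finset.univ < M.userValue α τ Finset.univ :=
  sub_lt_sub_left (mul_lt_mul_of_pos_left (infoOfPrecision_lt (M.totalPrecision_nonneg _ _)
    (M.totalPrecision_lt hγ h (Finset.mem_univ j) hj)) hα) _

lemma small_of_le (hα : 0 ≤ α) {σ τ : NoiseLevels K} (h : ∀ i, σ i ≤ τ i)
    (hσ : α * infoOfPrecision (M.totalPrecision σ Finset.univ) < 1 / 2) :
    α * infoOfPrecision (M.totalPrecision τ Finset.univ) < 1 / 2 :=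
  (mul_le_mul_of_nonneg_left
    (infoOfPrecision_le (M.totalPrecision_nonneg _ _) (M.totalPrecision_le h _)) hα).trans_lt hσ

lemma lt_userValue_univ {m : NoiseLevels K}
    (h : α * infoOfPrecision (M.totalPrecision m Finset.univ) < 1 / 2) :
    ((K : ℝ) - 1) / 2 < M.userValue α m Finset.univ := by
  rw [userValue, Finset.card_univ, Fintype.card_fin]
  linarith

end Market

open Market in
theorem proposition8 {d K : ℕ} (M : Market d K)
    (hsub : M.Substitutes)
    (hcost : ∀ i, M.IsLowCost i ∨ M.IsHighCost i)
    (hhigh : ∃ i, M.IsHighCost i)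
    (α : ℝ) (hα : ((K : ℝ) + 1) ^ 2 / 8 ≤ α)
    (hpriv : M.RequiresPrivacy α) :
    ∃ βhat : ℝ, ∀ β : ℝ, βhat ≤ β →
      (∃ (σbar : ℝ≥0) (s : StrategyProfile K),
        M.IsEquilibrium s α β (M.banLowCost σbar) ∧
        ∀ m : NoiseLevels K, (∀ i j, M.IsHighCost i → M.IsHighCost j → m i = m j) →
          ∀ t : StrategyProfile K, M.IsEquilibrium t α β m →
            M.userPayoff t α ≤ M.userPayoff s α ∧
            ((∃ i, M.IsLowCost i ∧ m i ≠ ⊤) → M.userPayoff t α < M.userPayoff s α)) ∧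
      ((∃ i, M.IsLowCost i) →
        ∃ σbar : ℝ≥0,
          (∃ s : StrategyProfile K, M.IsEquilibrium s α β (M.banLowCost σbar)) ∧
          ∀ s : StrategyProfile K, M.IsEquilibrium s α β (M.banLowCost σbar) →
            ∀ (r : ℝ≥0∞) (t : StrategyProfile K), M.IsEquilibrium t α β (fun _ => r) →
              M.userPayoff t α < M.userPayoff s α) := by
  have hα0 : 0 < α := lt_of_lt_of_le (by positivity) hα
  have hγ : ∀ i, M.γ i ≠ 0 := hpriv.γ_ne_zero hsub
  obtain ⟨r₀, hr₀⟩ := M.exists_small_uniform hα0.le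
  have hsmall : ∀ r, r₀ ≤ r →
      α * infoOfPrecision (M.totalPrecision (M.banLowCost r) Finset.univ) < 1 / 2 := fun r hr =>
    small_of_le hα0.le (le_banLowCost_of_isHighCost hcost fun i _ => by exact_mod_cast hr) hr₀
  obtain ⟨βhat, hβhat⟩ := Filter.eventually_atTop.1
    ((eventually_viable_uniform hγ r₀).and (Filter.eventually_gt_atTop 0))
  refine ⟨βhat, fun β hβ' => ?_⟩
  obtain ⟨hv₀, hβ⟩ := hβhat β hβ'
  constructor
  · -- the largest level at which all the high-cost platforms enter when the others are banned
    obtain ⟨R, hRv, hRmax⟩ := exists_isGreatest_viable hhigh hβ.le (σ := M.banLowCost)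
      (fun i => (hcost i).imp (fun hi r => banLowCost_of_isLowCost hi r)
        fun hi r => banLowCost_of_isHighCost hi r)
      (hv₀.banLowCost hcost hβ.le fun _ _ => rfl)
    have hR : r₀ ≤ R := hRmax (hv₀.banLowCost hcost hβ.le fun _ _ => rfl)
    obtain ⟨s, hs, hpay⟩ := exists_isEquilibrium hsub hα0.le hβ.le (hsmall R hR) hRv
    refine ⟨R, s, hs, fun m hm t ht => ?_⟩
    rw [hpay]
    rcases le_or_gt (M.userPayoff t α) (((K : ℝ) - 1) / 2) with hle | hlt
    · have := hle.trans_lt (lt_userValue_univ (hsmall R hR))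
      exact ⟨this.le, fun _ => this⟩
    · obtain ⟨htpay, htv⟩ := ht.of_lt_userPayoff hsub hγ hα0.le hβ hlt
      have htv : M.Viable β m := htv
      obtain ⟨h, hh⟩ := hhigh
      obtain ⟨r, hr⟩ : ∃ r : ℝ≥0, (r : ℝ≥0∞) = m h := ⟨_, ENNReal.coe_toNNReal (htv.ne_top hh)⟩
      have hmr : ∀ i, M.IsHighCost i → m i = r := fun i hi => by rw [hr, hm i h hi hh]
      have hrR : r ≤ R := hRmax (htv.banLowCost hcost hβ.le hmr)
      have hmle : ∀ i, m i ≤ M.banLowCost R i :=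
        le_banLowCost_of_isHighCost hcost fun i hi => by rw [hmr i hi]; exact_mod_cast hrR
      rw [htpay]
      refine ⟨userValue_le_userValue hα0.le hmle _, fun ⟨i, hi, hne⟩ => ?_⟩
      refine userValue_lt_userValue hγ hα0 hmle (j := i) ?_
      rw [banLowCost_of_isLowCost hi]
      exact lt_top_iff_ne_top.2 hne
  · intro hlow
    -- the largest level at which all platforms enter under a uniform mandate
    obtain ⟨R, hRv, hRmax⟩ := exists_isGreatest_viable hhigh hβ.le
      (σ := fun r _ => (r : ℝ≥0∞)) (fun i => Or.inr fun _ => rfl) hv₀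
    have hR : r₀ ≤ R := hRmax hv₀
    have hRlt := Viable.banLowCost_lt hcost hβ hγ hlow hRv
    obtain ⟨s₀, hs₀, -⟩ := exists_isEquilibrium hsub hα0.le hβ.le (hsmall R hR)
      fun i => (hRlt i).le
    refine ⟨R, ⟨s₀, hs₀⟩, fun s hs r t ht => ?_⟩
    rw [hs.userPayoff_eq_of_small hsub hγ hα0.le hβ (hsmall R hR) hRlt]
    rcases le_or_gt (M.userPayoff t α) (((K : ℝ) - 1) / 2) with hle | hlt
    · exact hle.trans_lt (lt_userValue_univ (hsmall R hR))
    · obtain ⟨htpay, htv⟩ := ht.of_lt_userPayoff hsub hγ hα0.le hβ hlt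
      have htv : M.Viable β fun _ => r := htv
      obtain ⟨h, hh⟩ := hhigh
      lift r to ℝ≥0 using htv.ne_top hh
      have hrR : r ≤ R := hRmax htv
      obtain ⟨j, hj⟩ := hlow
      rw [htpay]
      refine userValue_lt_userValue hγ hα0
        (le_banLowCost_of_isHighCost hcost fun _ _ => by exact_mod_cast hrR) (j := j) ?_
      rw [banLowCost_of_isLowCost hj]
      exact ENNReal.coe_lt_top
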